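/- Let $\mathbb F$ be a finite field of prime order, fixed throughout. For $d\ge 0$ let $\mathcal P_d(\mathbb F^n)$ be the space of functions $P:\mathbb F^n\to\mathbb F$ with $D_{h_1}\cdots D_{h_{d+1}}P=0$ for all $h_1,\dots,h_{d+1}\in\mathbb F^n$, where $D_hP(x)=P(x+h)-P(x)$. For $P:\mathbb F^n\to\mathbb F$ let $\operatorname{rank}_d(P)$ be the least integer $r\ge 0$ such that $P=B(Q_1,\dots,Q_r)$ for some $Q_1,\dots,Q_r\in\mathcal P_d(\mathbb F^n)$ and some function $B:\mathbb F^r\to\mathbb F$ (and $\operatorname{rank}_d(P)=\infty$ if there is no such $r$). A factor of order $d$ on $\mathbb F^n$ is a collection $\mathcal F=(P_{i,j})_{1\le i\le d,\,1\le j\le M_i}$ with integers $M_i\ge 0$ and $P_{i,j}\in\mathcal P_i(\mathbb F^n)$; its dimension is $\dim(\mathcal F)=M_1+\dots+M_d$. A growth function is a non-decreasing function $F$ from the non-negative integers to the positive reals, and $\mathcal F$ is $F$-regular if $\operatorname{rank}_{i-1}\big(\sum_{j=1}^{M_i}c_jP_{i,j}\big)\ge F(\dim(\mathcal F))$ for all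 $1\le i\le d$ and all $c_1,\dots,c_{M_i}\in\mathbb F$ that are not all zero. **Exact nullstellensatz.** Let $D,d,k\ge 0$ be integers. Then there exists a growth function $F$ (depending on $D,d,k$ and the fixed field $\mathbb F$, but not on $n$) with the following property. For every $n\ge 0$, every $F$-regular factor $\mathcal F=(P_{i,j})$ of order $d$ and dimension at most $D$ on $\mathbb F^n$, and every $Q\in\mathcal P_k(\mathbb F^n)$ which vanishes at every point where all the polynomials $P_{i,j}$ vanish, there exist polynomials $R_{i,j}\in\mathcal P_{k-i}(\mathbb F^n)$ for $1\le i\le\min(d,k)$ and $1\le j\le M_i$ such that $$Q(x)=\sum_{i=1}^{\min(d,k)}\sum_{j=1}^{M_i}R_{i,j}(x)\,P_{i,j}(x)\qquad\text{for all }x\in\mathbb F^n.$$ -/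

import Mathlib

namespace ExactNullstellensatz

/-- The vector space `𝔽ⁿ` over the prime field `𝔽 = ZMod p`. -/
abbrev Space (p n : ℕ) : Type := Fin n → ZMod p

/-- `P ∈ 𝒫_d(𝔽ⁿ)`: every `(d+1)`-fold additive derivative `D_{h₁} ⋯ D_{h_{d+1}} P` vanishes,
where `D_h P (x) = P (x + h) - P x` is Mathlib's `fwdDiff h P x`. -/
def IsPolyOfDegreeLE {p n : ℕ} (d : ℕ) (P : Space p n → ZMod p) : Prop :=
  ∀ h : List (Space p n), h.length = d + 1 → h.foldr fwdDiff P = 0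

/-- The degree `d` rank of `P`: the least `k` such that `P = B (Q₁, …, Q_k)` for some
`Q₁, …, Q_k ∈ 𝒫_d(𝔽ⁿ)` and some function `B : 𝔽ᵏ → 𝔽`; it is `⊤` if there is no such `k`. -/
noncomputable def rank {p n : ℕ} (d : ℕ) (P : Space p n → ZMod p) : ℕ∞ :=
  sInf {r : ℕ∞ | ∃ k : ℕ, r = k ∧ ∃ (Q : Fin k → Space p n → ZMod p) (B : (Fin k → ZMod p) → ZMod p),
    (∀ l, IsPolyOfDegreeLE d (Q l)) ∧ ∀ x, P x = B (fun l => Q l x)}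

/-- A factor of degree (order) `d` on `𝔽ⁿ`. The index `i : Fin d` stands for the degree `i + 1`,
so that `poly i j` is the polynomial `P_{i+1, j+1}` and `M i` is `M_{i+1}`. -/
structure Factor (p n d : ℕ) where
  M : Fin d → ℕ
  poly : (i : Fin d) → Fin (M i) → Space p n → ZMod p
  isPoly : ∀ i j, IsPolyOfDegreeLE (i.val + 1) (poly i j)

/-- The dimension `M₁ + ⋯ + M_d` of a factor. -/
def Factor.dim {p n d : ℕ} (𝓕 : Factor p n d) : ℕ := ∑ i, 𝓕.M i

/-- A growth function: non-decreasing with positive values. -/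
def IsGrowthFunction (F : ℕ → ℝ) : Prop := Monotone F ∧ ∀ m, 0 < F m

/-- `F`-regularity: any nontrivial linear combination of the polynomials in the degree `i` part
has degree `i - 1` rank at least `F (dim 𝓕)` (here the degree is `i.val + 1`). -/
def Factor.IsRegular {p n d : ℕ} (𝓕 : Factor p n d) (F : ℕ → ℝ) : Prop :=
  ∀ (i : Fin d) (c : Fin (𝓕.M i) → ZMod p), c ≠ 0 →
    ((F 𝓕.dim : ℝ) : EReal) ≤ ((rank i.val (fun x => ∑ j, c j * 𝓕.poly i j x) : ℕ∞) : EReal)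

end ExactNullstellensatz

namespace ExactNullstellensatz

open Finset

/-! Throughout, `W k` means degree less than `k`, so `W 0` consists of the negligible elements. Fix
the shape of the factor and suppose that no rank bound suffices. Counterexamples for the bounds 0,
1, 2, ... are assembled along a nonprincipal ultrafilter (`ultraFiltration`). A sum of products of
lower-degree elements, plus a lower-degree term, has bounded rank (`exists_eventually_rank_le`).
Hence in the limit the given polynomials are linearly independent modulo such decomposable elements
and extend to a family of weighted generators (`exists_isGenerating`).

The core is `indepAt`: the associated graded algebra is a truncated polynomial algebra, the only
relations between the generators being that p-th powers vanish in top degree. It is proved by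
differencing a hypothetical relation and inducting on the weight.

Now let Q vanish on the common zeros, so that Q · ∏ (Pᵢ^(p-1) - 1) = 0. In top degree,
multiplication by ∏ Pᵢ^(p-1) kills the monomials containing some Pᵢ and sends the others to distinct
reduced monomials. By independence every leading monomial of Q contains some Pᵢ. Dividing it out
costs no degree, and the remainder is treated by induction (`exists_eq_sum_mul`). The identity
obtained holds at some index of the sequence, a contradiction. -/

/-! ### Filtered algebras, generators and reduced monomials. -/

/-- A filtration of an `𝔽_p`-algebra by "degree less than `k`", which is governed by a family of
shifts: an element has degree less than `k + 1` exactly when all its differences have degree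
less than `k`. -/
structure DegreeFiltration (p : ℕ) (S H : Type*) [CommRing S] [Algebra (ZMod p) S] where
  W : ℕ → Submodule (ZMod p) S
  shift : H → S →ₐ[ZMod p] S
  mono : Monotone W
  one_mem : (1 : S) ∈ W 1
  one_notMem : (1 : S) ∉ W 0
  mul_mem : ∀ {a b : ℕ} {f g : S}, f ∈ W a → g ∈ W (b + 1) → f * g ∈ W (a + b)
  mul_mem_zero : ∀ {f : S} (g : S), f ∈ W 0 → f * g ∈ W 0
  exists_const : ∀ {f : S}, f ∈ W 1 → ∃ c : ZMod p, f - c • (1 : S) ∈ W 0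
  pow_sub_mem : ∀ f : S, f ^ p - f ∈ W 0
  mem_succ_iff : ∀ {k : ℕ} {f : S}, f ∈ W (k + 1) ↔ ∀ h, shift h f - f ∈ W k

namespace DegreeFiltration

variable {p : ℕ} {S H : Type*} [CommRing S] [Algebra (ZMod p) S] (𝓦 : DegreeFiltration p S H)
  {ι : Type*} (g : ι → S) (w : ι → ℕ)

/-- Sums of products of elements of smaller positive degree, up to terms of degree less than `k`. -/
def decomposable (k : ℕ) : Submodule (ZMod p) S :=
  Submodule.span (ZMod p) {x | ∃ i j a b, i + j = k ∧ 0 < i ∧ 0 < j ∧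
    a ∈ 𝓦.W (i + 1) ∧ b ∈ 𝓦.W (j + 1) ∧ x = a * b} ⊔ 𝓦.W k

/-- The monomial in the family `g` with exponents `e`. -/
def mon (e : ι →₀ ℕ) : S := e.prod fun i n => g i ^ n

@[simp] lemma mon_zero : mon g 0 = 1 := by simp [mon]

lemma mon_add (e e' : ι →₀ ℕ) : mon g (e + e') = mon g e * mon g e' := by
  classical
  exact Finsupp.prod_add_index' (fun _ => pow_zero _) (fun _ _ _ => pow_add _ _ _)

@[simp] lemma mon_single (i : ι) (n : ℕ) : mon g (Finsupp.single i n) = g i ^ n := by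
  simp [mon]

/-- Weighted homogeneous generators of positive weight for the filtered algebra, linearly
independent modulo decomposable elements. -/
structure IsGenerating : Prop where
  pos : ∀ i, 0 < w i
  mem : ∀ i, g i ∈ 𝓦.W (w i + 1)
  span : ∀ k, 0 < k →
    𝓦.W (k + 1) ≤ Submodule.span (ZMod p) (g '' {i | w i = k}) ⊔ 𝓦.decomposable k
  indep : ∀ k (c : ι →₀ ZMod p), (∀ i ∈ c.support, w i = k) →
    Finsupp.linearCombination (ZMod p) g c ∈ 𝓦.decomposable k → c = 0

/-- Combinations of monomials with exponents less than `p`, variables in `J` and weight less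
than `k`, up to elements of `W 0`. -/
def reducedSpan (J : Set ι) (k : ℕ) : Submodule (ZMod p) S :=
  Submodule.span (ZMod p)
    (mon g '' {e | (∀ i, e i < p) ∧ (∀ i ∉ J, e i = 0) ∧ Finsupp.weight w e < k}) ⊔ 𝓦.W 0

variable {𝓦 g w}

lemma mul_mem' {a b : ℕ} {f f' : S} (h : f ∈ 𝓦.W a) (h' : f' ∈ 𝓦.W (b + 1)) :
    f' * f ∈ 𝓦.W (a + b) := mul_comm f f' ▸ 𝓦.mul_mem h h'

lemma shift_mem {k : ℕ} {f : S} (h : H) (hf : f ∈ 𝓦.W k) : 𝓦.shift h f ∈ 𝓦.W k := by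
  have h1 := 𝓦.mem_succ_iff.1 (𝓦.mono k.le_succ hf) h
  simpa using add_mem h1 hf

lemma zero_le_reducedSpan (J : Set ι) (k : ℕ) : 𝓦.W 0 ≤ 𝓦.reducedSpan g w J k := le_sup_right

lemma reducedSpan_mono (J : Set ι) {k l : ℕ} (h : k ≤ l) :
    𝓦.reducedSpan g w J k ≤ 𝓦.reducedSpan g w J l := by
  refine sup_le_sup_right (Submodule.span_mono (Set.image_mono ?_)) _
  exact fun e he => ⟨he.1, he.2.1, he.2.2.trans_le h⟩

lemma pow_mem {k : ℕ} {f : S} (hf : f ∈ 𝓦.W (k + 1)) (n : ℕ) : f ^ n ∈ 𝓦.W (n * k + 1) := by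
  induction n with
  | zero => simpa using 𝓦.one_mem
  | succ n ih =>
    have := 𝓦.mul_mem ih hf
    rw [pow_succ]
    convert this using 2
    ring

lemma mon_mem (hg : ∀ i, g i ∈ 𝓦.W (w i + 1)) (e : ι →₀ ℕ) :
    mon g e ∈ 𝓦.W (Finsupp.weight w e + 1) := by
  induction e using Finsupp.induction_linear with
  | zero => simpa using 𝓦.one_mem
  | add e e' h h' =>
    rw [mon_add, map_add]
    convert 𝓦.mul_mem h h' using 2
    ring
  | single i n => simpa [Finsupp.weight_single] using pow_mem (hg i) n

lemma reducedSpan_le (hg : ∀ i, g i ∈ 𝓦.W (w i + 1)) (J : Set ι) (k : ℕ) :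
    𝓦.reducedSpan g w J k ≤ 𝓦.W k := by
  refine sup_le (Submodule.span_le.2 ?_) (𝓦.mono (Nat.zero_le k))
  rintro _ ⟨e, he, rfl⟩
  exact 𝓦.mono he.2.2 (mon_mem hg e)

/-- Since g^p = g modulo `W 0`, an exponent that is at least `p` can be lowered by `p - 1`. The drop
in `degree` makes repeated reduction terminate. -/
lemma exists_mon_sub_mem [hp : Fact p.Prime] (e : ι →₀ ℕ) (i : ι) (hi : p ≤ e i) :
    ∃ e' : ι →₀ ℕ, mon g e - mon g e' ∈ 𝓦.W 0 ∧
      Finsupp.weight w e' + (p - 1) * w i = Finsupp.weight w e ∧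
      e'.degree < e.degree ∧ ∀ j, e' j ≤ e j := by
  have hp2 := hp.out.two_le
  obtain ⟨r, rfl⟩ : ∃ r, e = Finsupp.single i p + r := by
    obtain ⟨r, hr⟩ := exists_add_of_le (Finsupp.single_le_iff.2 hi)
    exact ⟨r, hr⟩
  refine ⟨Finsupp.single i 1 + r, ?_, ?_, ?_, ?_⟩
  · rw [mon_add, mon_add, ← sub_mul]
    simpa using 𝓦.mul_mem_zero _ (𝓦.pow_sub_mem (g i))
  · simp only [map_add, Finsupp.weight_single, smul_eq_mul]
    obtain ⟨q, rfl⟩ : ∃ q, p = q + 1 := ⟨p - 1, by omega⟩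
    simp; ring
  · simp; omega
  · intro j
    classical
    simp only [Finsupp.add_apply, Finsupp.single_apply]
    split_ifs <;> omega

lemma mon_mem_reducedSpan [Fact p.Prime] (J : Set ι) (e : ι →₀ ℕ) (hJ : ∀ i ∉ J, e i = 0) :
    mon g e ∈ 𝓦.reducedSpan g w J (Finsupp.weight w e + 1) := by
  by_cases h : ∀ i, e i < p
  · exact Submodule.mem_sup_left (Submodule.subset_span ⟨e, ⟨h, hJ, Nat.lt_succ_self _⟩, rfl⟩)
  · push Not at h
    obtain ⟨i, hi⟩ := h
    obtain ⟨e', h1, h2, h3, h4⟩ := exists_mon_sub_mem (𝓦 := 𝓦) (g := g) (w := w) e i hi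
    have := mon_mem_reducedSpan J e' (fun j hj => Nat.le_zero.1 (hJ j hj ▸ h4 j))
    have := add_mem (zero_le_reducedSpan _ _ h1)
      (reducedSpan_mono J (show _ ≤ Finsupp.weight w e + 1 by omega) this)
    simpa using this
termination_by e.degree

/-- Weights are positive, so reducing an exponent strictly lowers the weight: non-reduced monomials
are zero in the associated graded algebra. -/
lemma mon_mem_of_not_reduced [hp : Fact p.Prime] (hG : 𝓦.IsGenerating g w) (e : ι →₀ ℕ)
    (i : ι) (hi : p ≤ e i) : mon g e ∈ 𝓦.W (Finsupp.weight w e) := by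
  obtain ⟨e', h1, h2, -⟩ := exists_mon_sub_mem (𝓦 := 𝓦) (g := g) (w := w) e i hi
  have h3 : 0 < (p - 1) * w i := Nat.mul_pos (by have := hp.out.two_le; omega) (hG.pos i)
  have := add_mem (𝓦.mono (Nat.zero_le (Finsupp.weight w e)) h1)
    (𝓦.mono (show _ ≤ Finsupp.weight w e by omega) (mon_mem hG.mem e'))
  simpa using this

lemma reducedSpan_mul_mem [Fact p.Prime] {J : Set ι} {k l : ℕ} {a b : S}
    (ha : a ∈ 𝓦.reducedSpan g w J k) (hb : b ∈ 𝓦.reducedSpan g w J (l + 1)) :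
    a * b ∈ 𝓦.reducedSpan g w J (k + l) := by
  obtain ⟨a, has, a', ha', rfl⟩ := Submodule.mem_sup.1 ha
  obtain ⟨b, hbs, b', hb', rfl⟩ := Submodule.mem_sup.1 hb
  rw [add_mul, mul_add]
  refine add_mem (add_mem ?_ ?_) (zero_le_reducedSpan _ _ (𝓦.mul_mem_zero _ ha'))
  · have := Submodule.mul_mem_mul has hbs
    rw [Submodule.span_mul_span] at this
    refine Submodule.span_le.2 ?_ this
    rintro _ ⟨_, ⟨e, he, rfl⟩, _, ⟨e', he', rfl⟩, rfl⟩
    have := mon_mem_reducedSpan (𝓦 := 𝓦) (g := g) (w := w) J (e + e')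
      (fun i hi => by simp [he.2.1 i hi, he'.2.1 i hi])
    have h1 := he.2.2
    have h2 := he'.2.2
    simp only [← mon_add]
    refine reducedSpan_mono J ?_ this
    rw [map_add]
    omega
  · exact zero_le_reducedSpan _ _ (mul_comm b' a ▸ 𝓦.mul_mem_zero _ hb')

/-- Induction on the degree: both factors of a decomposable product have positive degree, hence
smaller degree than the product. -/
lemma le_reducedSpan_univ [Fact p.Prime] (hG : 𝓦.IsGenerating g w) (k : ℕ) :
    𝓦.W k ≤ 𝓦.reducedSpan g w Set.univ k := by
  induction k using Nat.strong_induction_on with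
  | _ k ih =>
  rcases k with _ | _ | k
  · exact zero_le_reducedSpan _ _
  · intro f hf
    obtain ⟨c, hc⟩ := 𝓦.exists_const hf
    have h1 : (1 : S) ∈ 𝓦.reducedSpan g w Set.univ 1 := by
      simpa using mon_mem_reducedSpan (𝓦 := 𝓦) (g := g) (w := w) Set.univ 0 (by simp)
    simpa using add_mem (zero_le_reducedSpan _ _ hc) (Submodule.smul_mem _ c h1)
  · refine (hG.span (k + 1) k.succ_pos).trans (sup_le (Submodule.span_le.2 ?_)
      (sup_le (Submodule.span_le.2 ?_) ?_))
    · rintro _ ⟨i, hi, rfl⟩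
      rw [Set.mem_ofPred_eq] at hi
      have := mon_mem_reducedSpan (𝓦 := 𝓦) (g := g) (w := w) Set.univ (Finsupp.single i 1)
        (by simp)
      simpa [Finsupp.weight_single, hi] using this
    · rintro _ ⟨i, j, a, b, hij, hi, hj, ha, hb, rfl⟩
      have := reducedSpan_mul_mem (ih _ (by omega) ha) (ih _ (by omega) hb)
      exact reducedSpan_mono _ (by omega) this
    · exact (ih _ (by omega)).trans (reducedSpan_mono _ (by omega))

/-- The difference has degree less than `w β ≤ w α`, which leaves no room for a monomial containing
`g α`. -/
lemma shift_gen_sub_mem [Fact p.Prime] (hG : 𝓦.IsGenerating g w) {α β : ι} (hβ : w β ≤ w α)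
    (h : H) : 𝓦.shift h (g β) - g β ∈ 𝓦.reducedSpan g w {α}ᶜ (w β) := by
  suffices hle : 𝓦.reducedSpan g w Set.univ (w β) ≤ 𝓦.reducedSpan g w {α}ᶜ (w β) from
    hle (le_reducedSpan_univ hG _ (𝓦.mem_succ_iff.1 (hG.mem β) h))
  refine sup_le_sup_right (Submodule.span_mono (Set.image_mono ?_)) _
  rintro e ⟨h1, -, h3⟩
  refine ⟨h1, fun i hi => ?_, h3⟩
  obtain rfl : i = α := by simpa using hi
  by_contra h0
  have := Finsupp.le_weight_of_ne_zero' w h0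
  omega

lemma shift_mul_sub_mem [Fact p.Prime] {J : Set ι} {k l : ℕ} {a b : S} (h : H)
    (ha : a ∈ 𝓦.reducedSpan g w J (k + 1)) (hb : b ∈ 𝓦.reducedSpan g w J (l + 1))
    (ha' : 𝓦.shift h a - a ∈ 𝓦.reducedSpan g w J k)
    (hb' : 𝓦.shift h b - b ∈ 𝓦.reducedSpan g w J l) :
    𝓦.shift h (a * b) - a * b ∈ 𝓦.reducedSpan g w J (k + l) := by
  have h1 := reducedSpan_mul_mem ha' hb
  have h2 := reducedSpan_mul_mem hb' ha
  have h3 := reducedSpan_mul_mem ha' (reducedSpan_mono J l.le_succ hb')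
  rw [add_comm l k] at h2
  have := add_mem (add_mem h1 h2) h3
  rw [map_mul]
  convert this using 1
  ring

lemma shift_mon_sub_mem [Fact p.Prime] (hG : 𝓦.IsGenerating g w) (α : ι) (h : H) (e : ι →₀ ℕ)
    (he : ∀ i, e i ≠ 0 → w i ≤ w α) (hα : e α = 0) :
    𝓦.shift h (mon g e) - mon g e ∈ 𝓦.reducedSpan g w {α}ᶜ (Finsupp.weight w e) := by
  induction e using Finsupp.induction_linear with
  | zero => simp
  | add e e' ih ih' =>
    rw [mon_add, map_add]
    simp only [Finsupp.add_apply] at he hα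
    rw [Nat.add_eq_zero_iff] at hα
    refine shift_mul_sub_mem h (mon_mem_reducedSpan _ e ?_) (mon_mem_reducedSpan _ e' ?_)
      (ih (fun i hi => he i (by simp [hi])) hα.1) (ih' (fun i hi => he i (by simp [hi])) hα.2)
    · simpa using hα.1
    · simpa using hα.2
  | single i n =>
    induction n with
    | zero => simp
    | succ n ih =>
      have hi : i ≠ α := by rintro rfl; simp at hα
      have hw : w i ≤ w α := he i (by simp)
      have hs (m : ℕ) (j : ι) (hj : j ∉ ({α}ᶜ : Set ι)) : (Finsupp.single i m) j = 0 := by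
        obtain rfl : j = α := by simpa using hj
        simp [hi]
      rw [Finsupp.single_add, mon_add, map_add]
      refine shift_mul_sub_mem h (mon_mem_reducedSpan _ _ (hs n)) (mon_mem_reducedSpan _ _ (hs 1))
        (ih (fun j hj => ?_) (by simp [hi])) ?_
      · obtain rfl : j = i := by
          by_contra hne
          exact hj (by simp [Ne.symm hne])
        exact hw
      · simpa [Finsupp.weight_single] using shift_gen_sub_mem hG hw h

lemma linearCombination_mem_of_forall {κ : Type*} {v : κ → S} {N : Submodule (ZMod p) S}
    (a : κ →₀ ZMod p) (h : ∀ e ∈ a.support, v e ∈ N) :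
    Finsupp.linearCombination (ZMod p) v a ∈ N := by
  rw [Finsupp.linearCombination_apply]
  exact Submodule.sum_mem _ fun e he => Submodule.smul_mem _ _ (h e he)

lemma linearCombination_mul_const {κ : Type*} (v : κ → S) (x : S) (a : κ →₀ ZMod p) :
    Finsupp.linearCombination (ZMod p) (fun e => v e * x) a =
      Finsupp.linearCombination (ZMod p) v a * x := by
  simp only [Finsupp.linearCombination_apply, Finsupp.sum_mul, smul_mul_assoc]

lemma linearCombination_mapDomain_add (e' : ι →₀ ℕ) (a : (ι →₀ ℕ) →₀ ZMod p) :
    Finsupp.linearCombination (ZMod p) (mon g) (a.mapDomain (· + e')) =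
      Finsupp.linearCombination (ZMod p) (mon g) a * mon g e' := by
  rw [Finsupp.linearCombination_mapDomain, ← linearCombination_mul_const]
  congr 2
  funext e
  simp [mon_add]

lemma exists_linearCombination_sub_mem {J : Set ι} {m : ℕ} {x : S}
    (hx : x ∈ 𝓦.reducedSpan g w J (m + 1)) :
    ∃ u : (ι →₀ ℕ) →₀ ZMod p,
      (∀ e ∈ u.support, (∀ i, e i < p) ∧ (∀ i ∉ J, e i = 0) ∧ Finsupp.weight w e = m) ∧
      x - Finsupp.linearCombination (ZMod p) (mon g) u ∈ 𝓦.reducedSpan g w J m := by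
  classical
  obtain ⟨y, hy, z, hz, rfl⟩ := Submodule.mem_sup.1 hx
  obtain ⟨l, hl, rfl⟩ := (Finsupp.mem_span_image_iff_linearCombination (ZMod p)).1 hy
  rw [Finsupp.mem_supported] at hl
  refine ⟨l.filter (fun e => Finsupp.weight w e = m), ?_, ?_⟩
  · intro e he
    simp only [Finsupp.support_filter, Finset.mem_filter] at he
    exact ⟨(hl he.1).1, (hl he.1).2.1, he.2⟩
  · nth_rewrite 1 [← Finsupp.filter_add_filter_not l (fun e => Finsupp.weight w e = m)]
    rw [map_add, add_assoc, add_sub_cancel_left]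
    refine add_mem (linearCombination_mem_of_forall _ fun e he => ?_) (zero_le_reducedSpan _ _ hz)
    simp only [Finsupp.support_filter, Finset.mem_filter] at he
    have h1 := hl he.1
    refine Submodule.mem_sup_left (Submodule.subset_span ⟨e, ⟨h1.1, h1.2.1, ?_⟩, rfl⟩)
    have h2 := h1.2.2
    have h3 := he.2
    omega

/-! ### Independence of reduced monomials in the associated graded algebra. -/

variable (𝓦 g w) in
/-- The reduced monomials of weight `N` are linearly independent modulo `W N`. -/
def IndepAt (N : ℕ) : Prop :=
  ∀ a : (ι →₀ ℕ) →₀ ZMod p, (∀ e ∈ a.support, (∀ i, e i < p) ∧ Finsupp.weight w e = N) →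
    Finsupp.linearCombination (ZMod p) (mon g) a ∈ 𝓦.W N → a = 0

/-- The coefficient of `X_α ^ s` in a polynomial. -/
noncomputable def coeffAt (α : ι) (a : (ι →₀ ℕ) →₀ ZMod p) (s : ℕ) : (ι →₀ ℕ) →₀ ZMod p :=
  (a.filter (fun e => e α = s)).mapDomain (Finsupp.erase α)

lemma coeffAt_apply (α : ι) (a : (ι →₀ ℕ) →₀ ZMod p) (s : ℕ) (e : ι →₀ ℕ) :
    coeffAt α a s e = if e α = 0 then a (e + Finsupp.single α s) else 0 := by
  classical
  unfold coeffAt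
  induction a using Finsupp.induction_linear with
  | zero => simp [Finsupp.filter_zero]
  | add a b ha hb =>
    rw [Finsupp.filter_add, Finsupp.mapDomain_add, Finsupp.add_apply, ha, hb]
    split_ifs <;> simp
  | single e' c =>
    have key : (e' α = s ∧ e'.erase α = e) ↔ (e α = 0 ∧ e' = e + Finsupp.single α s) := by
      constructor
      · rintro ⟨rfl, rfl⟩
        exact ⟨by simp, by rw [Finsupp.erase_add_single]⟩
      · rintro ⟨h, rfl⟩
        refine ⟨by simp [h], ?_⟩
        ext j
        by_cases hj : j = α
        · subst hj; simp [h]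
        · simp [Finsupp.erase_ne hj]
    by_cases h : e' α = s
    · rw [Finsupp.filter_single_of_pos (fun e : ι →₀ ℕ => e α = s) h, Finsupp.mapDomain_single, Finsupp.single_apply,
        Finsupp.single_apply, ← ite_and]
      simp only [← key, h, true_and]
    · rw [Finsupp.filter_single_of_neg (fun e : ι →₀ ℕ => e α = s) h, Finsupp.single_apply, ← ite_and]
      simp only [← key, h, false_and]
      simp

lemma linearCombination_eq_sum_coeffAt (α : ι) (a : (ι →₀ ℕ) →₀ ZMod p)
    (ha : ∀ e ∈ a.support, e α < p) :
    Finsupp.linearCombination (ZMod p) (mon g) a =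
      ∑ s ∈ range p, Finsupp.linearCombination (ZMod p) (mon g) (coeffAt α a s) * g α ^ s := by
  classical
  have h : a.filter (fun e => e α < p) = a :=
    (Finsupp.filter_eq_self_iff _ _).2 fun e he => ha e (Finsupp.mem_support_iff.2 he)
  nth_rewrite 1 [← h]
  clear h ha
  unfold coeffAt
  induction a using Finsupp.induction_linear with
  | zero => simp [Finsupp.filter_zero]
  | add a b ha hb =>
    simp only [Finsupp.filter_add, Finsupp.mapDomain_add, map_add, add_mul, sum_add_distrib, ha, hb]
  | single e c =>
    have h1 (s : ℕ) : Finsupp.linearCombination (ZMod p) (mon g)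
        (((Finsupp.single e c).filter (fun e => e α = s)).mapDomain (Finsupp.erase α)) * g α ^ s =
        if e α = s then c • mon g e else 0 := by
      split_ifs with h
      · rw [Finsupp.filter_single_of_pos (fun e : ι →₀ ℕ => e α = s) h, Finsupp.mapDomain_single,
          Finsupp.linearCombination_single, smul_mul_assoc, ← mon_single, ← mon_add, ← h,
          Finsupp.erase_add_single]
      · rw [Finsupp.filter_single_of_neg (fun e : ι →₀ ℕ => e α = s) h]
        simp
    simp only [h1, sum_ite_eq, mem_range]
    split_ifs with h
    · rw [Finsupp.filter_single_of_pos (fun e : ι →₀ ℕ => e α < p) h, Finsupp.linearCombination_single]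
    · rw [Finsupp.filter_single_of_neg (fun e : ι →₀ ℕ => e α < p) h, map_zero]

/-- The leading parts of the `E s`, multiplied by `g α ^ s`, give disjoint sets of reduced monomials
of weight `N`, so independence kills each of them. If `s * w α > N`, both truncated bounds are 0 and
there is nothing to show. -/
lemma mem_of_sum_mul_pow_mem [Fact p.Prime] (hG : 𝓦.IsGenerating g w) {N : ℕ}
    (hN : 𝓦.IndepAt g w N) (α : ι) (E : ℕ → S)
    (hE : ∀ s < p, E s ∈ 𝓦.reducedSpan g w {α}ᶜ (N + 1 - s * w α))
    (hsum : ∑ s ∈ range p, E s * g α ^ s ∈ 𝓦.W N) (s : ℕ) (hs : s < p) :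
    E s ∈ 𝓦.W (N - s * w α) := by
  classical
  have key (s : ℕ) : ∃ u : (ι →₀ ℕ) →₀ ZMod p, s < p →
      (∀ e ∈ u.support, (∀ i, e i < p) ∧ e α = 0 ∧ Finsupp.weight w e + s * w α = N) ∧
      E s - Finsupp.linearCombination (ZMod p) (mon g) u ∈ 𝓦.W (N - s * w α) ∧
      (N < s * w α → u = 0) := by
    by_cases hs : s < p
    · rcases le_or_gt (s * w α) N with h | h
      · have := hE s hs
        rw [show N + 1 - s * w α = N - s * w α + 1 by omega] at this
        obtain ⟨u, hu, hu'⟩ := exists_linearCombination_sub_mem this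
        refine ⟨u, fun _ => ⟨fun e he => ⟨(hu e he).1, (hu e he).2.1 α (by simp), ?_⟩,
          reducedSpan_le hG.mem _ _ hu', fun h' => by omega⟩⟩
        have := (hu e he).2.2
        omega
      · refine ⟨0, fun _ => ⟨by simp, ?_, fun _ => rfl⟩⟩
        have := reducedSpan_le hG.mem _ _ (hE s hs)
        rw [show N + 1 - s * w α = N - s * w α by omega] at this
        simpa using this
    · exact ⟨0, fun h => absurd h hs⟩
  choose u hu using key
  suffices h0 : u s = 0 by simpa [h0] using (hu s hs).2.1
  set b := ∑ s ∈ range p, (u s).mapDomain (· + Finsupp.single α s) with hb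
  have hsupp (s' : ℕ) (hs' : s' < p) :
      ∀ e ∈ ((u s').mapDomain (· + Finsupp.single α s')).support, ∃ e' : ι →₀ ℕ,
        (∀ i, e' i < p) ∧ e' α = 0 ∧ Finsupp.weight w e' + s' * w α = N ∧
          e = e' + Finsupp.single α s' := by
    intro e he
    obtain ⟨e', he', rfl⟩ := Finset.mem_image.1 (Finsupp.mapDomain_support he)
    have := ((hu s' hs').1 e' he')
    exact ⟨e', this.1, this.2.1, this.2.2, rfl⟩
  have hb0 : b = 0 := by
    refine hN b ?_ ?_
    · intro e he
      obtain ⟨s', hs', he⟩ := Finset.mem_biUnion.1 (Finsupp.support_finsetSum he)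
      obtain ⟨e', h1, h2, h3, rfl⟩ := hsupp s' (mem_range.1 hs') e he
      refine ⟨fun i => ?_, by simpa [Finsupp.weight_single] using h3⟩
      by_cases hi : i = α
      · subst hi; simpa [h2] using hs'
      · simpa [Ne.symm hi] using h1 i
    · have : Finsupp.linearCombination (ZMod p) (mon g) b =
          ∑ s ∈ range p, E s * g α ^ s - ∑ s ∈ range p,
            (E s - Finsupp.linearCombination (ZMod p) (mon g) (u s)) * g α ^ s := by
        rw [hb, map_sum, ← sum_sub_distrib]
        refine sum_congr rfl fun s _ => ?_
        rw [linearCombination_mapDomain_add, mon_single]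
        ring
      rw [this]
      refine sub_mem hsum (Submodule.sum_mem _ fun s hs => ?_)
      have h1 := (hu s (mem_range.1 hs)).2.1
      rcases le_or_gt (s * w α) N with h | h
      · have := 𝓦.mul_mem h1 (pow_mem (hG.mem α) s)
        rwa [Nat.sub_add_cancel h] at this
      · rw [Nat.sub_eq_zero_of_le h.le] at h1
        exact 𝓦.mono (Nat.zero_le N) (𝓦.mul_mem_zero _ h1)
  ext e
  by_contra hne
  have he : e ∈ (u s).support := Finsupp.mem_support_iff.2 hne
  refine hne ?_
  have h1 : b (e + Finsupp.single α s) = u s e := by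
    rw [hb, Finsupp.finsetSum_apply, Finset.sum_eq_single_of_mem s (mem_range.2 hs)]
    · exact Finsupp.mapDomain_apply (add_left_injective _) _ _
    · intro s' hs' hne
      by_contra h
      obtain ⟨e', -, h2, -, h4⟩ := hsupp s' (mem_range.1 hs') _ (Finsupp.mem_support_iff.2 h)
      have := DFunLike.congr_fun h4 α
      simp [h2, ((hu s hs).1 e he).2.1] at this
      exact hne this.symm
  rw [← h1, hb0]
  rfl

/-- All monomials of weight `v` other than single generators are decomposable, so the relation
becomes a linear one between generators. -/
lemma apply_single_eq_zero (hG : 𝓦.IsGenerating g w) {v : ℕ} (hv : 0 < v)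
    (b : (ι →₀ ℕ) →₀ ZMod p) (hb : ∀ e ∈ b.support, Finsupp.weight w e = v)
    (hmem : Finsupp.linearCombination (ZMod p) (mon g) b ∈ 𝓦.W v) (α : ι) :
    b (Finsupp.single α 1) = 0 := by
  classical
  set σ : ι → (ι →₀ ℕ) := fun i => Finsupp.single i 1 with hσ
  have hinj : Function.Injective σ := fun i j h => by
    simpa [hσ, Finsupp.single_left_inj] using h
  set c := (b.filter (· ∈ Set.range σ)).comapDomain σ hinj.injOn with hc
  have hc' (i : ι) : c i = b (σ i) := by
    rw [hc, Finsupp.comapDomain_apply, Finsupp.filter_apply_pos _ _ ⟨i, rfl⟩]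
  have h1 : Finsupp.linearCombination (ZMod p) (mon g) (b.filter (· ∈ Set.range σ)) =
      Finsupp.linearCombination (ZMod p) g c := by
    rw [← Finsupp.mapDomain_comapDomain σ hinj (b.filter (· ∈ Set.range σ)),
      Finsupp.linearCombination_mapDomain]
    · congr 2
      funext i
      simp [hσ]
    · intro e he
      simp only [Finsupp.support_filter, Finset.coe_filter, Set.mem_ofPred_eq] at he
      exact he.2
  have h2 : Finsupp.linearCombination (ZMod p) (mon g) (b.filter (¬ · ∈ Set.range σ)) ∈
      𝓦.decomposable v := by
    refine linearCombination_mem_of_forall _ fun e he => ?_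
    simp only [Finsupp.support_filter, Finset.mem_filter] at he
    have hw := hb e he.1
    obtain ⟨i, hi⟩ : ∃ i, e i ≠ 0 := by
      by_contra! h
      obtain rfl : e = 0 := by ext i; exact h i
      simp at hw
      omega
    obtain ⟨e', rfl⟩ : ∃ e', e = Finsupp.single i 1 + e' :=
      exists_add_of_le (Finsupp.single_le_iff.2 (Nat.one_le_iff_ne_zero.2 hi))
    obtain ⟨j, hj⟩ : ∃ j, e' j ≠ 0 := by
      by_contra! h
      obtain rfl : e' = 0 := by ext i; exact h i
      exact he.2 ⟨i, by simp [hσ]⟩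
    refine Submodule.mem_sup_left (Submodule.subset_span
      ⟨w i, Finsupp.weight w e', g i, mon g e', ?_, hG.pos i, ?_, hG.mem i, mon_mem hG.mem e', ?_⟩)
    · rw [← hw, map_add, Finsupp.weight_single]; simp
    · exact (hG.pos j).trans_le (Finsupp.le_weight_of_ne_zero' w hj)
    · rw [mon_add, mon_single, pow_one]
  have h3 : c = 0 := by
    refine hG.indep v c ?_ ?_
    · intro i hi
      have := hb (σ i) (by simpa [hc'] using hi)
      simpa [hσ, Finsupp.weight_single] using this
    · rw [← Finsupp.filter_add_filter_not b (· ∈ Set.range σ), map_add, h1] at hmem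
      have := sub_mem (Submodule.mem_sup_right hmem : _ ∈ 𝓦.decomposable v) h2
      rwa [add_sub_cancel_right] at this
  have := hc' α
  rw [h3] at this
  exact this.symm

/-- First-order Taylor expansion: terms at least quadratic in the difference of `x` lose two
degrees. -/
lemma shift_pow_sub_mem {v : ℕ} {x : S} (hx : x ∈ 𝓦.W (v + 1 + 1)) (h : H) (s : ℕ) :
    𝓦.shift h x ^ s - x ^ s - s * x ^ (s - 1) * (𝓦.shift h x - x) ∈ 𝓦.W (s * (v + 1) - 1) := by
  induction s with
  | zero => simp
  | succ s ih =>
    have hd := 𝓦.mem_succ_iff.1 hx h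
    have hτ := shift_mem h hx
    set τ := 𝓦.shift h x
    have h1 := mul_mem' ih hτ
    rcases s with _ | s
    · simp
    · have h2 : x ^ s * ((τ - x) * (τ - x)) ∈ 𝓦.W ((s + 2) * (v + 1) - 1) := by
        have h3 := mul_mem' (𝓦.mul_mem hd hd) (pow_mem hx s)
        refine 𝓦.mono (le_of_eq ?_) h3
        rw [eq_tsub_iff_add_eq_of_le (by nlinarith)]
        ring
      have h4 := Submodule.smul_of_tower_mem (𝓦.W ((s + 2) * (v + 1) - 1)) (s + 1) h2
      rw [show (s + 1) * (v + 1) - 1 + (v + 1) = (s + 2) * (v + 1) - 1 by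
        rw [eq_tsub_iff_add_eq_of_le (by nlinarith)]
        have : 1 ≤ (s + 1) * (v + 1) := by nlinarith
        zify [this]; ring] at h1
      convert add_mem h1 h4 using 1
      rw [nsmul_eq_mul]
      push_cast
      ring

lemma shift_mul_pow_sub_mem {v N s : ℕ} {x C : S} (hx : x ∈ 𝓦.W (v + 1 + 1)) (h : H)
    (hC : C ∈ 𝓦.W (N + 1 - s * (v + 1) + 1)) (hC0 : N + 1 < s * (v + 1) → C = 0) :
    𝓦.shift h (C * x ^ s) - C * x ^ s -
      ((𝓦.shift h C - C) * x ^ s + s * (C * x ^ (s - 1) * (𝓦.shift h x - x))) ∈ 𝓦.W N := by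
  rcases lt_or_ge (N + 1) (s * (v + 1)) with hlt | hle
  · simp [hC0 hlt]
  have h1 := mul_mem' (shift_pow_sub_mem hx h s) hC
  have h2 := 𝓦.mem_succ_iff.1 hC h
  have h3 := 𝓦.mem_succ_iff.1 (pow_mem hx s) h
  have key : C * (𝓦.shift h x ^ s - x ^ s - s * x ^ (s - 1) * (𝓦.shift h x - x)) ∈ 𝓦.W N ∧
      (𝓦.shift h C - C) * (𝓦.shift h x ^ s - x ^ s) ∈ 𝓦.W N := by
    rcases s with _ | s
    · simp
    · have hs : 1 ≤ (s + 1) * (v + 1) := by nlinarith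
      refine ⟨𝓦.mono (by omega) h1, ?_⟩
      rw [map_pow, ← Nat.sub_add_cancel hs] at h3
      exact 𝓦.mono (by omega) (𝓦.mul_mem h2 h3)
  convert add_mem key.1 key.2 using 1
  rw [map_mul, map_pow]
  ring

/-- Write a relation as a polynomial ∑ C_s G^s in a generator `G` of maximal weight. Differencing
lowers the weight, so by induction each coefficient δC_s + (s+1) C_{s+1} δG of the differenced
relation has lower degree than expected. The two top coefficients then contradict either
independence in smaller weight or indecomposability of `G`. -/
theorem indepAt [hp : Fact p.Prime] (hG : 𝓦.IsGenerating g w) (N : ℕ) : 𝓦.IndepAt g w N := by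
  classical
  induction N using Nat.strong_induction_on with
  | _ N ih =>
  intro a ha hmem
  by_contra hne
  rcases N with _ | N
  · have hsupp : ∀ e ∈ a.support, e = 0 := by
      intro e he
      ext i
      by_contra hi
      have := Finsupp.le_weight_of_ne_zero' w hi
      have := hG.pos i
      have := (ha e he).2
      omega
    have ha0 : a = Finsupp.single 0 (a 0) := by
      ext e
      by_cases he : e = 0
      · simp [he]
      · rw [Finsupp.single_eq_of_ne he]
        by_contra h
        exact he (hsupp e (Finsupp.mem_support_iff.2 h))
    have hc : a 0 ≠ 0 := fun h => hne (by rw [ha0, h, Finsupp.single_zero])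
    rw [ha0, Finsupp.linearCombination_single, mon_zero] at hmem
    exact 𝓦.one_notMem ((Submodule.smul_mem_iff _ hc).1 hmem)
  have hvar : (a.support.biUnion Finsupp.support).Nonempty := by
    obtain ⟨e, he⟩ := Finsupp.support_nonempty_iff.2 hne
    have hw := (ha e he).2
    have : e ≠ 0 := by rintro rfl; simp at hw
    obtain ⟨i, hi⟩ := Finsupp.support_nonempty_iff.2 this
    exact ⟨i, mem_biUnion.2 ⟨e, he, hi⟩⟩
  -- Maximality of the weight makes the differences of all generators involved free of `g α`.
  obtain ⟨α, hα, hmax⟩ := exists_max_image _ w hvar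
  obtain ⟨e₁, he₁, he₁α⟩ := mem_biUnion.1 hα
  rw [Finsupp.mem_support_iff] at he₁α
  have hle (e) (he : e ∈ a.support) (i) (hi : e i ≠ 0) : w i ≤ w α :=
    hmax i (mem_biUnion.2 ⟨e, he, Finsupp.mem_support_iff.2 hi⟩)
  obtain ⟨e₀, he₀, htop⟩ := exists_max_image a.support (fun e => e α) ⟨e₁, he₁⟩
  obtain ⟨r, hr⟩ : ∃ r, e₀ α = r + 1 :=
    Nat.exists_eq_succ_of_ne_zero (by have := htop e₁ he₁; omega)
  have hrp : r + 1 < p := hr ▸ (ha e₀ he₀).1 α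
  obtain ⟨v, hv⟩ : ∃ v, w α = v + 1 := Nat.exists_eq_succ_of_ne_zero (hG.pos α).ne'
  have hcoeff (s : ℕ) (e) (he : e ∈ (coeffAt α a s).support) :
      (∀ i, e i < p) ∧ e α = 0 ∧ (∀ i, e i ≠ 0 → w i ≤ w α) ∧
        Finsupp.weight w e + s * w α = N + 1 ∧ s ≤ r + 1 := by
    rw [Finsupp.mem_support_iff, coeffAt_apply] at he
    obtain ⟨h1, h2⟩ := ite_ne_right_iff.1 he
    have h3 := Finsupp.mem_support_iff.2 h2
    have h4 := ha _ h3
    have h5 (i) : e i ≤ (e + Finsupp.single α s) i := by simp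
    refine ⟨fun i => (h5 i).trans_lt (h4.1 i), h1, fun i hi => hle _ h3 i ?_, ?_, ?_⟩
    · have := h5 i
      omega
    · simpa [Finsupp.weight_single] using h4.2
    · simpa [h1, hr] using htop _ h3
  set C : ℕ → S := fun s => Finsupp.linearCombination (ZMod p) (mon g) (coeffAt α a s) with hC
  set G := g α with hGα
  have hGmem : G ∈ 𝓦.W (v + 1 + 1) := hv ▸ hG.mem α
  have hC0 (s : ℕ) (hs : N + 1 < s * w α ∨ r + 1 < s) : C s = 0 := by
    have : coeffAt α a s = 0 := by
      by_contra h
      obtain ⟨e, he⟩ := Finsupp.support_nonempty_iff.2 h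
      have := hcoeff s e he
      omega
    simp [hC, this]
  have hCmem (s : ℕ) : C s ∈ 𝓦.reducedSpan g w {α}ᶜ (N + 1 - s * w α + 1) := by
    refine linearCombination_mem_of_forall _ fun e he => ?_
    have := hcoeff s e he
    refine Submodule.mem_sup_left (Submodule.subset_span ⟨e, ⟨this.1, ?_, ?_⟩, rfl⟩)
    · simpa using this.2.1
    · have := this.2.2.2.1
      omega
  have hδC (h : H) (s : ℕ) :
      𝓦.shift h (C s) - C s ∈ 𝓦.reducedSpan g w {α}ᶜ (N + 1 - s * w α) := by
    simp only [hC, Finsupp.linearCombination_apply, Finsupp.sum, map_sum, map_smul,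
      ← sum_sub_distrib, ← smul_sub]
    refine Submodule.sum_mem _ fun e he => Submodule.smul_mem _ _ ?_
    have := hcoeff s e he
    refine reducedSpan_mono _ ?_ (shift_mon_sub_mem hG α h e this.2.2.1 this.2.1)
    have := this.2.2.2.1
    omega
  have hdecomp : Finsupp.linearCombination (ZMod p) (mon g) a = ∑ s ∈ range p, C s * G ^ s :=
    linearCombination_eq_sum_coeffAt α a fun e he => (ha e he).1 α
  have hδ (h : H) (s : ℕ) (hs : s < p) :
      𝓦.shift h (C s) - C s + ((s + 1 : ℕ) : S) * (C (s + 1) * (𝓦.shift h G - G)) ∈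
        𝓦.W (N - s * w α) := by
    refine mem_of_sum_mul_pow_mem hG (ih N N.lt_succ_self) α (fun s => 𝓦.shift h (C s) - C s +
      ((s + 1 : ℕ) : S) * (C (s + 1) * (𝓦.shift h G - G))) (fun s hs => ?_) ?_ s hs
    · refine add_mem (hδC h s) ?_
      rw [← nsmul_eq_mul]
      refine Submodule.smul_of_tower_mem _ _ ?_
      rcases lt_or_ge (N + 1) ((s + 1) * w α) with hlt | hge
      · simp [hC0 _ (Or.inl hlt)]
      · have := reducedSpan_mul_mem (shift_gen_sub_mem hG le_rfl h) (hCmem (s + 1))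
        rw [mul_comm (C (s + 1))]
        refine reducedSpan_mono _ ?_ this
        rw [add_mul, one_mul] at hge ⊢
        omega
    · have h1 := 𝓦.mem_succ_iff.1 hmem h
      rw [hdecomp, map_sum, ← sum_sub_distrib] at h1
      have h2 : ∑ s ∈ range p, (𝓦.shift h (C s * G ^ s) - C s * G ^ s -
          ((𝓦.shift h (C s) - C s) * G ^ s + s * (C s * G ^ (s - 1) * (𝓦.shift h G - G)))) ∈
          𝓦.W N := by
        refine Submodule.sum_mem _ fun s _ => shift_mul_pow_sub_mem hGmem h ?_ ?_
        · rw [← hv]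
          exact reducedSpan_le hG.mem _ _ (hCmem s)
        · rw [← hv]
          exact fun hlt => hC0 s (Or.inl hlt)
      rw [sum_sub_distrib] at h2
      have h3 := sub_mem h1 h2
      rw [sub_sub_cancel, sum_add_distrib] at h3
      convert h3 using 1
      simp only [add_mul, sum_add_distrib]
      congr 1
      -- Index shift: the term at 0 has the factor `s = 0`, and the term at `p` vanishes because `r
      -- + 1 < p`.
      have h4 := Finset.sum_range_succ' (fun s : ℕ => (s : S) * (C s * G ^ (s - 1) *
        (𝓦.shift h G - G))) p
      rw [Finset.sum_range_succ, hC0 p (Or.inr hrp)] at h4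
      simp only [zero_mul, mul_zero, add_zero, Nat.cast_zero, Nat.add_sub_cancel] at h4
      rw [h4]
      refine sum_congr rfl fun s _ => ?_
      push_cast
      ring
  have hCtop : coeffAt α a (r + 1) ≠ 0 := by
    intro h
    have h1 := coeffAt_apply α a (r + 1) (e₀.erase α)
    rw [h, if_pos (by simp), ← hr, Finsupp.erase_add_single] at h1
    exact Finsupp.mem_support_iff.1 he₀ h1.symm
  obtain ⟨e', he'⟩ := Finsupp.support_nonempty_iff.2 hCtop
  have hwt := (hcoeff _ e' he').2.2.2.1
  -- Either the top coefficient `C (r + 1)` is a nonzero constant, or it has positive weight.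
  rcases Nat.eq_zero_or_pos (N + 1 - (r + 1) * w α) with hN | hN
  · have hsupp : ∀ e ∈ (coeffAt α a (r + 1)).support, e = 0 := by
      intro e he
      ext i
      by_contra hi
      have := Finsupp.le_weight_of_ne_zero' w hi
      have := hG.pos i
      have := (hcoeff _ e he).2.2.2.1
      omega
    set c := coeffAt α a (r + 1) 0 with hc
    have hc0 : c ≠ 0 := by
      rw [hsupp e' he'] at he'
      exact Finsupp.mem_support_iff.1 he'
    have hCc : C (r + 1) = c • (1 : S) := by
      have : coeffAt α a (r + 1) = Finsupp.single 0 c := by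
        ext e
        by_cases he : e = 0
        · simp [he, hc]
        · rw [Finsupp.single_eq_of_ne he]
          by_contra h
          exact he (hsupp e (Finsupp.mem_support_iff.2 h))
      simp only [hC, this, Finsupp.linearCombination_single, mon_zero]
    have hNv : N + 1 = r * w α + (v + 1) := by
      rw [add_mul, hv] at *
      omega
    set b := coeffAt α a r + Finsupp.single (Finsupp.single α 1) (((r + 1 : ℕ) : ZMod p) * c)
      with hb
    have hbC : Finsupp.linearCombination (ZMod p) (mon g) b =
        C r + ((r + 1 : ℕ) : S) * (C (r + 1) * G) := by
      rw [hb, map_add, Finsupp.linearCombination_single, mon_single, pow_one, hCc, mul_smul,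
        smul_one_mul, Nat.cast_smul_eq_nsmul, nsmul_eq_mul]
    -- With `C (r + 1) = c` constant, `hδ` at `s = r` bounds the differences of `C r + (r + 1) c G`.
    -- The coefficient of `G` in it is `(r + 1) c`, nonzero since `r + 1 < p`, while `C r` is free
    -- of `G`.
    have hbmem : Finsupp.linearCombination (ZMod p) (mon g) b ∈ 𝓦.W (v + 1) := by
      rw [𝓦.mem_succ_iff, hbC]
      intro h
      have := hδ h r (by omega)
      rw [show N - r * w α = v by omega] at this
      convert this using 1
      rw [hCc]
      simp only [map_add, map_mul, map_natCast, map_smul, map_one]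
      ring
    have hb1 := apply_single_eq_zero hG v.succ_pos b (fun e he => ?_) hbmem α
    · rw [hb, Finsupp.add_apply, coeffAt_apply, if_neg (by simp), zero_add,
        Finsupp.single_eq_same, mul_eq_zero, or_iff_left hc0,
        ZMod.natCast_eq_zero_iff] at hb1
      exact absurd (Nat.le_of_dvd r.succ_pos hb1) (by omega)
    · rcases Finset.mem_union.1 (Finsupp.support_add he) with he | he
      · have := (hcoeff r e he).2.2.2.1
        omega
      · obtain rfl := Finset.mem_singleton.1 (Finsupp.support_single_subset he)
        simp [Finsupp.weight_single, hv]
  -- At `s = r + 1` there is no next coefficient, so `hδ` bounds the differences of `C (r + 1)`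
  -- alone; this is a relation of smaller weight.
  · refine hCtop (ih (N + 1 - (r + 1) * w α) ?_ _ (fun e he => ?_) ?_)
    · have : 0 < (r + 1) * w α := Nat.mul_pos r.succ_pos (hG.pos α)
      omega
    · have := hcoeff _ e he
      exact ⟨this.1, by have := this.2.2.2.1; omega⟩
    · rw [← Nat.sub_add_cancel hN, 𝓦.mem_succ_iff]
      intro h
      have := hδ h (r + 1) hrp
      rw [hC0 (r + 1 + 1) (Or.inr (Nat.lt_succ_self _)), zero_mul, mul_zero, add_zero] at this
      refine 𝓦.mono ?_ this
      omega

/-! ### Generating families and the nullstellensatz in a filtered algebra. -/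

/-- Elements of given positive degrees, linearly independent modulo decomposable elements, are
part of a generating family. -/
lemma exists_isGenerating [Fact p.Prime] {κ : Type*} (f : κ → S) (wf : κ → ℕ)
    (hpos : ∀ i, 0 < wf i) (hmem : ∀ i, f i ∈ 𝓦.W (wf i + 1))
    (hind : ∀ k (c : κ →₀ ZMod p), (∀ i ∈ c.support, wf i = k) →
      Finsupp.linearCombination (ZMod p) f c ∈ 𝓦.decomposable k → c = 0) :
    ∃ (T : Set (ℕ × S)) (φ : κ → T), 𝓦.IsGenerating (fun x : T => x.1.2) (fun x => x.1.1) ∧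
      Function.Injective φ ∧ ∀ i, (φ i : ℕ × S) = (wf i, f i) := by
  classical
  have hli (k : ℕ) : LinearIndependent (ZMod p)
      (fun i : {i // wf i = k} => (𝓦.decomposable k).mkQ (f i)) := by
    rw [linearIndependent_iff]
    intro c hc
    have h1 := hind k (c.mapDomain Subtype.val) ?_ ?_
    · exact Finsupp.mapDomain_injective Subtype.val_injective (by simpa using h1)
    · intro i hi
      obtain ⟨j, -, rfl⟩ := Finset.mem_image.1 (Finsupp.mapDomain_support hi)
      exact j.2
    · rw [← Submodule.ker_mkQ (𝓦.decomposable k), LinearMap.mem_ker,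
        Finsupp.linearCombination_mapDomain, Finsupp.apply_linearCombination]
      exact hc
  have hB (k : ℕ) : ∃ B : Set S, f '' {i | wf i = k} ⊆ B ∧ B ⊆ 𝓦.W (k + 1) ∧
      (𝓦.decomposable k).mkQ '' (𝓦.W (k + 1)) ⊆
        Submodule.span (ZMod p) ((𝓦.decomposable k).mkQ '' B) ∧
      LinearIndepOn (ZMod p) (𝓦.decomposable k).mkQ B := by
    have h1 : LinearIndepOn (ZMod p) (𝓦.decomposable k).mkQ (f '' {i | wf i = k}) := by
      have h2 : LinearIndepOn (ZMod p) ((𝓦.decomposable k).mkQ ∘ f) {i | wf i = k} := hli k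
      exact h2.image_of_comp _ _
    obtain ⟨B, h2, h3, h4, h5⟩ := exists_linearIndepOn_extension h1
      (t := (𝓦.W (k + 1) : Set S)) (by rintro _ ⟨i, rfl, rfl⟩; exact hmem i)
    exact ⟨B, h3, h2, h4, h5⟩
  choose B hfB hBW hspan hBi using hB
  refine ⟨{x | 0 < x.1 ∧ x.2 ∈ B x.1}, fun i => ⟨(wf i, f i), hpos i, hfB _ ⟨i, rfl, rfl⟩⟩,
    ⟨fun x => x.2.1, fun x => hBW _ x.2.2, ?_, ?_⟩, ?_, fun i => rfl⟩
  · intro k hk x hx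
    have h1 := hspan k ⟨x, hx, rfl⟩
    rw [← Submodule.map_span] at h1
    obtain ⟨y, hy, hyx⟩ := h1
    rw [Submodule.mkQ_apply, Submodule.mkQ_apply, Submodule.Quotient.eq] at hyx
    rw [← sub_sub_cancel y x]
    refine sub_mem (Submodule.mem_sup_left (Submodule.span_mono ?_ hy))
      (Submodule.mem_sup_right hyx)
    exact fun b hb => ⟨⟨(k, b), hk, hb⟩, rfl, rfl⟩
  · intro k c hc hmem
    let v : {x : ℕ × S | 0 < x.1 ∧ x.2 ∈ B x.1} → S := fun x => x.1.2
    have hinj : Set.InjOn v {x | x.1.1 = k} := fun x hx y hy hxy =>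
      Subtype.ext (Prod.ext (Eq.trans hx (Eq.symm hy)) hxy)
    have h1 := linearIndepOn_iff.1 (hBi k) (c.mapDomain v) ?_ ?_
    · exact Finsupp.mapDomain_injOn _ hinj (fun x hx => hc x hx) (fun x hx => by simp at hx)
        (h1.trans Finsupp.mapDomain_zero.symm)
    · intro x hx
      obtain ⟨y, hy, rfl⟩ := Finset.mem_image.1 (Finsupp.mapDomain_support hx)
      exact hc y hy ▸ y.2.2
    · rw [Finsupp.linearCombination_mapDomain, ← Finsupp.apply_linearCombination,
        ← LinearMap.mem_ker, Submodule.ker_mkQ]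
      exact hmem
  · intro i j hij
    obtain ⟨h1, h2⟩ := Prod.ext_iff.1 (Subtype.ext_iff.1 hij)
    have := (hli (wf j)).injective (a₁ := ⟨i, h1⟩) (a₂ := ⟨j, rfl⟩) (congrArg _ h2)
    simpa using this

/-- Every other term of the expanded product omits a factor of positive weight. -/
lemma prod_pow_sub_mem [hp : Fact p.Prime] (hG : 𝓦.IsGenerating g w) {κ : Type*} (φ : κ → ι)
    (s : Finset κ) :
    ∏ i ∈ s, (g (φ i) ^ (p - 1) - 1) - mon g (∑ i ∈ s, Finsupp.single (φ i) (p - 1)) ∈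
      𝓦.W (Finsupp.weight w (∑ i ∈ s, Finsupp.single (φ i) (p - 1))) := by
  classical
  induction s using Finset.induction_on with
  | empty => simp
  | insert i s hi ih =>
    rw [Finset.prod_insert hi, Finset.sum_insert hi, mon_add, mon_single, map_add]
    set Y := ∏ i ∈ s, (g (φ i) ^ (p - 1) - 1)
    set m := ∑ i ∈ s, Finsupp.single (φ i) (p - 1)
    have hY : Y ∈ 𝓦.W (Finsupp.weight w m + 1) := by
      simpa using add_mem (𝓦.mono (Nat.le_succ _) ih) (mon_mem hG.mem m)
    have h1 := mul_mem' ih (pow_mem (hG.mem (φ i)) (p - 1))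
    have h2 : 0 < (p - 1) * w (φ i) :=
      Nat.mul_pos (by have := hp.out.two_le; omega) (hG.pos _)
    rw [Finsupp.weight_single, smul_eq_mul]
    have h3 := sub_mem (𝓦.mono (show _ ≤ (p - 1) * w (φ i) + Finsupp.weight w m by omega) h1)
      (𝓦.mono (show _ ≤ (p - 1) * w (φ i) + Finsupp.weight w m by omega) hY)
    convert h3 using 1
    ring

/-- If `Q` vanishes on the common zeros of some of the generators, then it lies in the ideal that
they generate, without loss in the degrees. -/
theorem exists_eq_sum_mul [hp : Fact p.Prime] (hG : 𝓦.IsGenerating g w) {κ : Type*} [Fintype κ]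
    (φ : κ → ι) (hφ : Function.Injective φ) (k : ℕ) (Q : S) (hQ : Q ∈ 𝓦.W k)
    (hvan : Q * ∏ i, (g (φ i) ^ (p - 1) - 1) ∈ 𝓦.W 0) :
    ∃ R : κ → S, (∀ i, R i ∈ 𝓦.W (k - w (φ i))) ∧ Q - ∑ i, R i * g (φ i) ∈ 𝓦.W 0 := by
  classical
  have hp2 := hp.out.two_le
  induction k generalizing Q with
  | zero => exact ⟨0, fun _ => zero_mem _, by simpa using hQ⟩
  | succ k ih =>
  set m := ∑ i, Finsupp.single (φ i) (p - 1) with hm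
  have hmφ (i : κ) : m (φ i) = p - 1 := by
    rw [hm, Finsupp.finsetSum_apply, Finset.sum_eq_single_of_mem i (mem_univ i)]
    · simp
    · intro j _ hj
      exact Finsupp.single_eq_of_ne (hφ.ne hj.symm)
  have hm0 (j : ι) (hj : j ∉ Set.range φ) : m j = 0 := by
    rw [hm, Finsupp.finsetSum_apply]
    exact Finset.sum_eq_zero fun i _ => Finsupp.single_eq_of_ne fun h => hj ⟨i, h.symm⟩
  obtain ⟨u, hu, hQu⟩ := exists_linearCombination_sub_mem (le_reducedSpan_univ hG _ hQ)
  replace hQu := reducedSpan_le hG.mem _ _ hQu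
  -- Leading monomials avoiding all `φ i` stay reduced and distinct after multiplication by `mon g
  -- m`. The others acquire an exponent at least `p` and drop in degree.
  have hfree : u.filter (fun e => ∀ i, e (φ i) = 0) = 0 := by
    refine Finsupp.mapDomain_injective (add_left_injective m)
      ((indepAt hG (k + Finsupp.weight w m) _ ?_ ?_).trans Finsupp.mapDomain_zero.symm)
    · intro e he
      obtain ⟨e', he', rfl⟩ := Finset.mem_image.1 (Finsupp.mapDomain_support he)
      simp only [Finsupp.support_filter, Finset.mem_filter] at he'
      have := hu e' he'.1
      refine ⟨fun j => ?_, by simp [this.2.2]⟩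
      by_cases hj : j ∈ Set.range φ
      · obtain ⟨i, rfl⟩ := hj
        simp only [Finsupp.add_apply, he'.2, hmφ]
        omega
      · simpa [hm0 j hj] using this.1 j
    · rw [linearCombination_mapDomain_add]
      have h1 : Q * mon g m ∈ 𝓦.W (k + Finsupp.weight w m) := by
        have h2' := mul_comm Q _ ▸ 𝓦.mul_mem (prod_pow_sub_mem hG φ univ) hQ
        have h3 := sub_mem (𝓦.mono (Nat.zero_le (Finsupp.weight w m + k)) hvan) h2'
        rw [add_comm]
        convert h3 using 1
        ring
      have h4 := 𝓦.mul_mem hQu (mon_mem hG.mem m)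
      have h5 : Finsupp.linearCombination (ZMod p) (mon g)
          (u.filter (fun e => ¬ ∀ i, e (φ i) = 0)) * mon g m ∈ 𝓦.W (k + Finsupp.weight w m) := by
        rw [← linearCombination_mul_const]
        refine linearCombination_mem_of_forall _ fun e he => ?_
        simp only [Finsupp.support_filter, Finset.mem_filter, not_forall] at he
        obtain ⟨he, i, hi⟩ := he
        have := mon_mem_of_not_reduced hG (e + m) (φ i) (by simp only [Finsupp.add_apply, hmφ]; omega)
        rwa [mon_add, map_add, (hu e he).2.2] at this
      have h6 := sub_mem (sub_mem h1 h4) h5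
      nth_rewrite 1 [← Finsupp.filter_add_filter_not u (fun e => ∀ i, e (φ i) = 0)] at h6
      rw [map_add] at h6
      convert h6 using 1
      ring
  have hR : ∃ R : κ → S, (∀ i, R i ∈ 𝓦.W (k + 1 - w (φ i))) ∧
      Finsupp.linearCombination (ZMod p) (mon g) u = ∑ i, R i * g (φ i) := by
    let N : Submodule (ZMod p) S :=
      { carrier := {x | ∃ R : κ → S, (∀ i, R i ∈ 𝓦.W (k + 1 - w (φ i))) ∧
          x = ∑ i, R i * g (φ i)}
        zero_mem' := ⟨0, fun _ => zero_mem _, by simp⟩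
        add_mem' := by
          rintro _ _ ⟨R, hR, rfl⟩ ⟨R', hR', rfl⟩
          exact ⟨R + R', fun i => add_mem (hR i) (hR' i), by simp [add_mul, sum_add_distrib]⟩
        smul_mem' := by
          rintro c _ ⟨R, hR, rfl⟩
          exact ⟨c • R, fun i => Submodule.smul_mem _ _ (hR i), by simp [Finset.smul_sum]⟩ }
    refine linearCombination_mem_of_forall (N := N) u fun e he => ?_
    obtain ⟨i, hi⟩ : ∃ i, e (φ i) ≠ 0 := by
      by_contra! h
      have := DFunLike.congr_fun hfree e
      rw [Finsupp.filter_apply_pos _ _ h] at this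
      exact Finsupp.mem_support_iff.1 he this
    obtain ⟨e', rfl⟩ : ∃ e', e = e' + Finsupp.single (φ i) 1 := by
      obtain ⟨r, hr⟩ := exists_add_of_le (Finsupp.single_le_iff.2 (Nat.one_le_iff_ne_zero.2 hi))
      exact ⟨r, hr.trans (add_comm _ _)⟩
    refine ⟨Pi.single i (mon g e'), fun j => ?_, ?_⟩
    · by_cases hj : j = i
      · subst hj
        rw [Pi.single_eq_same]
        have h1 := (hu _ he).2.2
        rw [map_add, Finsupp.weight_single, one_smul] at h1
        rw [← h1, show Finsupp.weight w e' + w (φ j) + 1 - w (φ j) = Finsupp.weight w e' + 1 by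
          omega]
        exact mon_mem hG.mem e'
      · rw [Pi.single_eq_of_ne hj]
        exact zero_mem _
    · rw [Finset.sum_eq_single_of_mem i (mem_univ i), Pi.single_eq_same, mon_add, mon_single,
        pow_one]
      intro j _ hj
      rw [Pi.single_eq_of_ne hj, zero_mul]
  obtain ⟨R, hR, hRu⟩ := hR
  -- The remainder still satisfies the vanishing hypothesis, since `x * (x ^ (p - 1) - 1) = x ^ p -
  -- x` is negligible.
  obtain ⟨R', hR', hQR'⟩ := ih _ hQu (by
    rw [sub_mul, hRu, Finset.sum_mul]
    refine sub_mem hvan (Submodule.sum_mem _ fun i _ => ?_)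
    rw [← Finset.mul_prod_erase _ _ (mem_univ i)]
    have := 𝓦.mul_mem_zero (R i * ∏ j ∈ univ.erase i, (g (φ j) ^ (p - 1) - 1))
      (𝓦.pow_sub_mem (g (φ i)))
    convert this using 1
    obtain ⟨q, rfl⟩ : ∃ q, p = q + 1 := ⟨p - 1, by omega⟩
    rw [Nat.add_sub_cancel]
    ring)
  refine ⟨R + R', fun i => add_mem (hR i) (𝓦.mono (by omega) (hR' i)), ?_⟩
  convert hQR' using 1
  rw [hRu]
  simp only [Pi.add_apply, add_mul, sum_add_distrib]
  ring

end DegreeFiltration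

/-! ### Degree and rank of functions on 𝔽ⁿ. -/

variable {p n : ℕ}

/-- Every `k`-fold additive derivative vanishes: `f` has degree less than `k`, or is zero
if `k = 0`. -/
def DegreeLT (k : ℕ) (f : Space p n → ZMod p) : Prop :=
  ∀ h : List (Space p n), h.length = k → h.foldr fwdDiff f = 0

lemma degreeLT_zero {f : Space p n → ZMod p} : DegreeLT 0 f ↔ f = 0 :=
  ⟨fun h => h [] rfl, fun h l hl => by rw [List.length_eq_zero_iff.1 hl]; exact h⟩

lemma degreeLT_succ {k : ℕ} {f : Space p n → ZMod p} :
    DegreeLT (k + 1) f ↔ ∀ h, DegreeLT k (fwdDiff h f) := by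
  constructor
  · intro hf h l hl
    have := hf (l ++ [h]) (by simp [hl])
    simpa using this
  · intro hf l hl
    obtain ⟨l', h, rfl⟩ : ∃ l' h, l = l' ++ [h] := by
      rcases List.eq_nil_or_concat l with rfl | ⟨l', h, rfl⟩
      · simp at hl
      · exact ⟨l', h, by simp⟩
    have := hf h l' (by simpa using hl)
    simpa using this

lemma DegreeLT.add {k : ℕ} {f g : Space p n → ZMod p} (hf : DegreeLT k f) (hg : DegreeLT k g) :
    DegreeLT k (f + g) := by
  induction k generalizing f g with
  | zero => rw [degreeLT_zero] at *; rw [hf, hg, add_zero]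
  | succ k ih =>
    rw [degreeLT_succ] at *
    intro h
    rw [fwdDiff_add]
    exact ih (hf h) (hg h)

lemma DegreeLT.smul {k : ℕ} {f : Space p n → ZMod p} (c : ZMod p) (hf : DegreeLT k f) :
    DegreeLT k (c • f) := by
  induction k generalizing f with
  | zero => rw [degreeLT_zero] at *; rw [hf, smul_zero]
  | succ k ih =>
    rw [degreeLT_succ] at *
    intro h
    rw [fwdDiff_const_smul]
    exact ih (hf h)

lemma degreeLT_zero_fun (k : ℕ) : DegreeLT k (0 : Space p n → ZMod p) := by
  induction k with
  | zero => rw [degreeLT_zero]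
  | succ k ih =>
    rw [degreeLT_succ]
    intro h
    convert ih
    ext x
    simp [fwdDiff]

lemma DegreeLT.succ {k : ℕ} {f : Space p n → ZMod p} (hf : DegreeLT k f) :
    DegreeLT (k + 1) f := by
  induction k generalizing f with
  | zero => rw [degreeLT_zero.1 hf]; exact degreeLT_zero_fun _
  | succ k ih =>
    rw [degreeLT_succ] at hf ⊢
    exact fun h => ih (hf h)

lemma DegreeLT.mul {a b : ℕ} {f g : Space p n → ZMod p} (hf : DegreeLT a f)
    (hg : DegreeLT (b + 1) g) : DegreeLT (a + b) (f * g) := by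
  induction a generalizing b f g with
  | zero => rw [degreeLT_zero.1 hf, zero_mul]; exact degreeLT_zero_fun _
  | succ a iha =>
    induction b generalizing f g with
    | zero =>
      rw [degreeLT_succ] at hf hg
      rw [add_zero, degreeLT_succ]
      intro h
      have hg0 := degreeLT_zero.1 (hg h)
      have : fwdDiff h (f * g) = fwdDiff h f * g := by
        ext x
        have := congrFun hg0 x
        simp only [fwdDiff, Pi.mul_apply, Pi.zero_apply, sub_eq_zero] at this ⊢
        rw [this]; ring
      rw [this]
      exact iha (b := 0) (hf h) (degreeLT_succ.2 hg)
    | succ b ihb =>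
      have hf' := degreeLT_succ.1 hf
      have hg' := degreeLT_succ.1 hg
      rw [show a + 1 + (b + 1) = (a + 1 + b) + 1 by ring, degreeLT_succ]
      intro h
      have : fwdDiff h (f * g) =
          fwdDiff h f * g + f * fwdDiff h g + fwdDiff h f * fwdDiff h g := by
        ext x
        simp only [fwdDiff, Pi.mul_apply, Pi.add_apply]
        ring
      rw [this]
      refine ((?_ : DegreeLT _ _).add (ihb hf (hg' h))).add ?_
      · have := iha (hf' h) hg
        rwa [show a + (b + 1) = a + 1 + b by ring] at this
      · have := (iha (hf' h) (hg' h)).succ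
        rwa [show a + b + 1 = a + 1 + b by ring] at this

lemma rank_le {d m : ℕ} {P : Space p n → ZMod p} (Q : Fin m → Space p n → ZMod p)
    (B : (Fin m → ZMod p) → ZMod p) (hQ : ∀ l, IsPolyOfDegreeLE d (Q l))
    (hP : ∀ x, P x = B (fun l => Q l x)) : rank d P ≤ m :=
  sInf_le ⟨m, rfl, Q, B, hQ, hP⟩

lemma rank_sum_mul_add_le {d m : ℕ} (A B : Fin m → Space p n → ZMod p) (C : Space p n → ZMod p)
    (hA : ∀ l, IsPolyOfDegreeLE d (A l)) (hB : ∀ l, IsPolyOfDegreeLE d (B l))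
    (hC : IsPolyOfDegreeLE d C) :
    rank d (fun x => ∑ l, A l x * B l x + C x) ≤ (m + m + 1 : ℕ) := by
  refine rank_le (Fin.append (Fin.append A B) (fun _ => C))
    (fun y => ∑ l : Fin m, y (Fin.castAdd 1 (Fin.castAdd m l)) *
      y (Fin.castAdd 1 (Fin.natAdd m l)) + y (Fin.natAdd (m + m) 0)) ?_ ?_
  · intro l
    refine Fin.addCases (fun l => ?_) (fun l => ?_) l
    · refine Fin.addCases (fun l => ?_) (fun l => ?_) l
      · simpa only [Fin.append_left] using hA l
      · simpa only [Fin.append_left, Fin.append_right] using hB l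
    · simpa only [Fin.append_right] using hC
  · intro x
    simp only [Fin.append_left, Fin.append_right]

/-! ### The ultraproduct and the compactness argument. -/

open Filter in
/-- The ultraproduct, along a nonprincipal ultrafilter on `ℕ`, of the algebras of functions on
the spaces `Space p (n N)`, filtered by degree. -/
noncomputable def ultraFiltration (p : ℕ) [Fact p.Prime] (n : ℕ → ℕ) :
    DegreeFiltration p (∀ N, Space p (n N) → ZMod p) (∀ N, Space p (n N)) where
  W k :=
    { carrier := {f | ∀ᶠ N in hyperfilter ℕ, DegreeLT k (f N)}
      zero_mem' := Eventually.of_forall fun _ => degreeLT_zero_fun k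
      add_mem' := fun hf hg => by filter_upwards [hf, hg] with N h1 h2 using h1.add h2
      smul_mem' := fun c f hf => by filter_upwards [hf] with N h1 using h1.smul c }
  shift h :=
    { toFun := fun f N x => f N (x + h N)
      map_one' := rfl
      map_mul' := fun _ _ => rfl
      map_zero' := rfl
      map_add' := fun _ _ => rfl
      commutes' := fun _ => rfl }
  mono := by
    refine monotone_nat_of_le_succ fun k f hf => ?_
    filter_upwards [hf] with N h1 using h1.succ
  one_mem := by
    refine Eventually.of_forall fun N => ?_
    rw [degreeLT_succ]
    intro h
    rw [degreeLT_zero]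
    ext x
    simp [fwdDiff]
  one_notMem := by
    intro h
    obtain ⟨N, hN⟩ := h.exists
    have := congrFun (degreeLT_zero.1 hN) 0
    simp at this
  mul_mem := fun hf hg => by filter_upwards [hf, hg] with N h1 h2 using h1.mul h2
  mul_mem_zero := by
    intro f g hf
    filter_upwards [hf] with N h1
    rw [degreeLT_zero] at h1 ⊢
    rw [Pi.mul_apply, h1, zero_mul]
  exists_const := by
    intro f hf
    -- The constants may vary with `N`, but they lie in a finite set, so the ultrafilter selects
    -- one.
    have h1 : ∀ᶠ N in hyperfilter ℕ, ∃ c ∈ (Set.univ : Set (ZMod p)), f N 0 = c :=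
      Eventually.of_forall fun N => ⟨_, trivial, rfl⟩
    obtain ⟨c, -, hc⟩ := (Ultrafilter.eventually_exists_mem_iff Set.finite_univ).1 h1
    refine ⟨c, ?_⟩
    filter_upwards [hf, hc] with N h2 h3
    rw [degreeLT_zero]
    ext x
    have h4 := congrFun (degreeLT_zero.1 (degreeLT_succ.1 h2 x)) 0
    simp only [fwdDiff, zero_add, Pi.zero_apply, sub_eq_zero] at h4
    simp [h4, h3]
  pow_sub_mem := by
    refine fun f => Eventually.of_forall fun N => ?_
    rw [degreeLT_zero]
    ext x
    simp
  mem_succ_iff := by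
    intro k f
    constructor
    · intro hf h
      filter_upwards [hf] with N h1 using degreeLT_succ.1 h1 (h N)
    · intro hf
      by_contra h
      have h1 : ∀ᶠ N in hyperfilter ℕ, ¬ DegreeLT (k + 1) (f N) :=
        Ultrafilter.eventually_not.2 h
      -- Choosing a bad direction at each index gives a single sequence of shifts that violates the
      -- hypothesis.
      have h2 (N : ℕ) : ∃ h, ¬ DegreeLT (k + 1) (f N) → ¬ DegreeLT k (fwdDiff h (f N)) := by
        by_cases hN : DegreeLT (k + 1) (f N)
        · exact ⟨0, fun h => absurd hN h⟩
        · rw [degreeLT_succ, not_forall] at hN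
          exact ⟨hN.choose, fun _ => hN.choose_spec⟩
      choose h' hh' using h2
      obtain ⟨N, h3, h4⟩ := (h1.and (hf h')).exists
      exact hh' N h3 h4

-- The number `m` of products does not depend on `N`, and each factor has degree at most `r` because
-- its cofactor has positive degree; so `2m + 1` polynomials suffice.
open Filter DegreeFiltration in
lemma exists_eventually_rank_le {p : ℕ} [Fact p.Prime] {n : ℕ → ℕ} {r : ℕ}
    {f : ∀ N, Space p (n N) → ZMod p} (hf : f ∈ (ultraFiltration p n).decomposable (r + 1)) :
    ∃ m : ℕ, ∀ᶠ N in hyperfilter ℕ, rank r (f N) ≤ m := by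
  obtain ⟨y, hy, z, hz, rfl⟩ := Submodule.mem_sup.1 hf
  obtain ⟨m, A, B, hA, hB, rfl⟩ : ∃ (m : ℕ) (A B : Fin m → ∀ N, Space p (n N) → ZMod p),
      (∀ l, A l ∈ (ultraFiltration p n).W (r + 1)) ∧
      (∀ l, B l ∈ (ultraFiltration p n).W (r + 1)) ∧ y = ∑ l, A l * B l := by
    clear hf
    induction hy using Submodule.span_induction with
    | mem x hx =>
      obtain ⟨i, j, a, b, hij, hi, hj, ha, hb, rfl⟩ := hx
      exact ⟨1, fun _ => a, fun _ => b, fun _ => (ultraFiltration p n).mono (by omega) ha,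
        fun _ => (ultraFiltration p n).mono (by omega) hb, by simp⟩
    | zero => exact ⟨0, Fin.elim0, Fin.elim0, fun l => l.elim0, fun l => l.elim0, by simp⟩
    | add x y _ _ hx hy =>
      obtain ⟨m, A, B, hA, hB, rfl⟩ := hx
      obtain ⟨m', A', B', hA', hB', rfl⟩ := hy
      refine ⟨m + m', Fin.append A A', Fin.append B B', fun l => ?_, fun l => ?_, ?_⟩
      · refine Fin.addCases (fun l => ?_) (fun l => ?_) l
        · simpa only [Fin.append_left] using hA l
        · simpa only [Fin.append_right] using hA' l
      · refine Fin.addCases (fun l => ?_) (fun l => ?_) l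
        · simpa only [Fin.append_left] using hB l
        · simpa only [Fin.append_right] using hB' l
      · simp only [Fin.sum_univ_add, Fin.append_left, Fin.append_right]
    | smul c x _ hx =>
      obtain ⟨m, A, B, hA, hB, rfl⟩ := hx
      exact ⟨m, c • A, B, fun l => Submodule.smul_mem _ c (hA l), hB, by simp [smul_sum]⟩
  refine ⟨m + m + 1, ?_⟩
  have hA' := eventually_all.2 hA
  have hB' := eventually_all.2 hB
  filter_upwards [hA', hB', hz] with N h1 h2 h3
  have := rank_sum_mul_add_le (fun l => A l N) (fun l => B l N) (z N) h1 h2 h3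
  convert this using 2
  ext x
  simp

open Filter DegreeFiltration in
theorem exists_rank_bound (p : ℕ) [Fact p.Prime] {κ : Type*} [Fintype κ] (deg : κ → ℕ)
    (hdeg : ∀ i, 0 < deg i) (k : ℕ) :
    ∃ r₀ : ℕ, ∀ (n : ℕ) (P : κ → Space p n → ZMod p), (∀ i, IsPolyOfDegreeLE (deg i) (P i)) →
      (∀ (r : ℕ) (c : κ → ZMod p), c ≠ 0 → (∀ i, c i ≠ 0 → deg i = r + 1) →
        (r₀ : ℕ∞) ≤ rank r (fun x => ∑ i, c i * P i x)) →
      ∀ Q : Space p n → ZMod p, IsPolyOfDegreeLE k Q → (∀ x, (∀ i, P i x = 0) → Q x = 0) →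
        ∃ R : κ → Space p n → ZMod p,
          (∀ i, deg i ≤ k → IsPolyOfDegreeLE (k - deg i) (R i)) ∧
          ∀ x, Q x = ∑ i with deg i ≤ k, R i x * P i x := by
  by_contra hcon
  push Not at hcon
  choose n P hP hrank Q hQ hvan hno using hcon
  set 𝓦 := ultraFiltration p n
  obtain ⟨T, φ, hG, hφ, hφf⟩ := 𝓦.exists_isGenerating (fun i N => P N i) deg hdeg
    (fun i => Eventually.of_forall fun N => hP N i) (by
      intro k' c hc hmem
      by_contra hne
      obtain ⟨i, hi⟩ := Finsupp.support_nonempty_iff.2 hne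
      obtain ⟨r, rfl⟩ : ∃ r, k' = r + 1 :=
        Nat.exists_eq_succ_of_ne_zero (by rw [← hc i hi]; exact (hdeg i).ne')
      obtain ⟨m, hm⟩ := exists_eventually_rank_le hmem
      have hlarge : ∀ᶠ N in hyperfilter ℕ, m < N :=
        (Nat.hyperfilter_le_atTop) (eventually_gt_atTop m)
      obtain ⟨N, h1, h2⟩ := (hm.and hlarge).exists
      have h3 := hrank N r c (fun h => hne (DFunLike.coe_injective h))
        (fun i hi => hc i (Finsupp.mem_support_iff.2 hi))
      have h4 : (fun x => ∑ i, c i * P N i x) =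
          Finsupp.linearCombination (ZMod p) (fun i N => P N i) c N := by
        ext x
        rw [Finsupp.linearCombination_apply, Finsupp.sum_fintype _ _ (by simp)]
        simp
      rw [h4] at h3
      have h5 := h3.trans h1
      norm_cast at h5
      omega)
  obtain ⟨R, hR, hQR⟩ := exists_eq_sum_mul hG φ hφ (k + 1) Q (Eventually.of_forall hQ) (by
    -- Off the common zeros some factor `P ^ (p - 1) - 1` vanishes by Fermat's little theorem.
    refine Eventually.of_forall fun N => degreeLT_zero.2 ?_
    ext x
    simp only [hφf, Pi.mul_apply, Finset.prod_apply, Pi.sub_apply, Pi.pow_apply, Pi.one_apply,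
      Pi.zero_apply, mul_eq_zero]
    by_cases h : ∀ i, P N i x = 0
    · exact Or.inl (hvan N x h)
    · push Not at h
      obtain ⟨i, hi⟩ := h
      refine Or.inr (Finset.prod_eq_zero (mem_univ i) ?_)
      rw [ZMod.pow_card_sub_one_eq_one hi, sub_self])
  simp only [hφf] at hR hQR
  obtain ⟨N, h1, h2⟩ := ((eventually_all.2 hR).and hQR).exists
  obtain ⟨x, hx⟩ := hno N (fun i => R i N) (fun i hi => by
    have := h1 i
    rwa [Nat.sub_add_comm hi] at this)
  refine hx ?_
  have h3 := congrFun (degreeLT_zero.1 h2) x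
  simp only [Pi.sub_apply, Finset.sum_apply, Pi.mul_apply, Pi.zero_apply, sub_eq_zero] at h3
  rw [h3, Finset.sum_filter]
  refine sum_congr rfl fun i _ => ?_
  split_ifs with hi
  · rfl
  -- If `deg i > k`, the bound `k + 1 - deg i` truncates to 0, so this coefficient is zero.
  · have h4 := h1 i
    rw [Nat.sub_eq_zero_of_le (by omega)] at h4
    rw [degreeLT_zero.1 h4, Pi.zero_apply, zero_mul]

/-! ### Uniformity over the shapes of factors. -/

lemma natCast_le_of_ereal_le {m : ℕ} {r : ℕ∞} (h : ((m : ℝ) : EReal) ≤ (r : EReal)) :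
    (m : ℕ∞) ≤ r := by
  induction r using ENat.recTopCoe with
  | top => exact le_top
  | coe r =>
    have : ((m : ℝ) : EReal) ≤ ((r : ℝ) : EReal) := h
    exact_mod_cast this

end ExactNullstellensatz

theorem mainTheorem9 (p : ℕ) [Fact p.Prime] (D d k : ℕ) :
    ∃ F : ℕ → ℝ, ExactNullstellensatz.IsGrowthFunction F ∧
      ∀ (n : ℕ) (𝓕 : ExactNullstellensatz.Factor p n d),
        𝓕.IsRegular F → 𝓕.dim ≤ D →
        ∀ Q : ExactNullstellensatz.Space p n → ZMod p,
          ExactNullstellensatz.IsPolyOfDegreeLE k Q →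
          (∀ x, (∀ i j, 𝓕.poly i j x = 0) → Q x = 0) →
          ∃ R : (i : Fin d) → Fin (𝓕.M i) → ExactNullstellensatz.Space p n → ZMod p,
            (∀ i j, i.val + 1 ≤ k →
              ExactNullstellensatz.IsPolyOfDegreeLE (k - (i.val + 1)) (R i j)) ∧
            ∀ x, Q x = ∑ i : Fin d with i.val + 1 ≤ k, ∑ j, R i j x * 𝓕.poly i j x := by
  have hbound (M : Fin d → ℕ) := ExactNullstellensatz.exists_rank_bound p
    (κ := Σ i, Fin (M i)) (fun x => x.1.val + 1) (fun _ => Nat.succ_pos _) k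
  choose r₀ hr₀ using hbound
  -- Only finitely many shapes `M` have dimension at most `D`, so a constant growth function
  -- suffices; the `+ 1` makes it positive.
  set B : ℕ := (Fintype.piFinset fun _ : Fin d => Finset.range (D + 1)).sup r₀ + 1 with hB
  refine ⟨fun _ => (B : ℝ), ⟨monotone_const, fun _ => by positivity⟩, ?_⟩
  rintro n ⟨M, poly, isPoly⟩ hreg hdim Q hQ hvan
  have hM : r₀ M ≤ B := by
    refine (Finset.le_sup (Fintype.mem_piFinset.2 fun i => Finset.mem_range.2 ?_)).trans
      (Nat.le_succ _)
    exact Nat.lt_succ_of_le ((Finset.single_le_sum (f := M) (fun _ _ => Nat.zero_le _)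
      (Finset.mem_univ i)).trans hdim)
  have hrank : ∀ (r : ℕ) (c : (Σ i, Fin (M i)) → ZMod p), c ≠ 0 →
      (∀ x, c x ≠ 0 → x.1.val + 1 = r + 1) →
      (r₀ M : ℕ∞) ≤ ExactNullstellensatz.rank r (fun y => ∑ x, c x * poly x.1 x.2 y) := by
    intro r c hc hdeg
    obtain ⟨⟨i, j⟩, hij⟩ := Function.ne_iff.1 hc
    obtain rfl : i.val = r := Nat.succ_injective (hdeg ⟨i, j⟩ hij)
    have h1 := ExactNullstellensatz.natCast_le_of_ereal_le
      (hreg i (fun j => c ⟨i, j⟩) (Function.ne_iff.2 ⟨j, hij⟩))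
    refine (Nat.cast_le.2 hM).trans (h1.trans_eq ?_)
    congr 1
    ext x
    rw [Fintype.sum_sigma, Finset.sum_eq_single_of_mem i (Finset.mem_univ i)]
    intro i' _ hi'
    refine Finset.sum_eq_zero fun j' _ => ?_
    have : c ⟨i', j'⟩ = 0 := by
      by_contra h
      exact hi' (Fin.ext (Nat.succ_injective (hdeg ⟨i', j'⟩ h)))
    rw [this, zero_mul]
  obtain ⟨R, hR, hQR⟩ := hr₀ M n (fun x => poly x.1 x.2) (fun x => isPoly x.1 x.2) hrank Q hQ
    (fun x hx => hvan x fun i j => hx ⟨i, j⟩)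
  refine ⟨fun i j => R ⟨i, j⟩, fun i j hi => hR ⟨i, j⟩ hi, fun x => ?_⟩
  rw [hQR x, Finset.sum_filter, Fintype.sum_sigma, Finset.sum_filter]
  refine Finset.sum_congr rfl fun i _ => ?_
  split_ifs with hi
  · rfl
  · simp
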